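/- Let $n\ge 1$ and let $B_n$ be the braid group on $n$ strands, with Artin's presentation: generators $\sigma_1,\dots,\sigma_{n-1}$ and relations $\sigma_i\sigma_j=\sigma_j\sigma_i$ for $|i-j|>1$, $\sigma_i\sigma_j\sigma_i=\sigma_j\sigma_i\sigma_j$ for $|i-j|=1$. For $n\ge t>s\ge 1$ let $$a_{ts}=(\sigma_{t-1}\sigma_{t-2}\cdots\sigma_{s+1})\,\sigma_s\,(\sigma_{t-1}\sigma_{t-2}\cdots\sigma_{s+1})^{-1}\in B_n ,$$ let $B_n^+\subset B_n$ be the submonoid generated by all $a_{ts}$ (the positive braids), and let $\delta=a_{n(n-1)}a_{(n-1)(n-2)}\cdots a_{21}$. For $V,W\in B_n$ write $V\le W$ if $W=P_1VP_2$ for some $P_1,P_2\in B_n^+$, and let $[0,1]=\{A\in B_n: e\le A\le\delta\}$, where $e$ is the identity. A permutation $\pi$ of $\{1,\dots,n\}$ is a descending cycle if it is a cycle $(t_j,t_{j-1},\dots,t_1)$ with $j\ge 2$ and $t_j>t_{j-1}>\dots>t_1$; put $\delta_\pi=a_{t_jt_{j-1}}a_{t_{j-1}t_{j-2}}\cdots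 a_{t_2t_1}$. Descending cycles $(t_j,\dots,t_1)$ and $(s_i,\dots,s_1)$ are parallel if $(t_a-s_c)(t_a-s_d)(t_b-s_c)(t_b-s_d)>0$ for all $1\le a<b\le j$ and $1\le c<d\le i$. Theorem. A braid $A\in B_n$ lies in $[0,1]$ if and only if $A=\delta_{\pi_1}\delta_{\pi_2}\cdots\delta_{\pi_k}$ for some $k\ge 0$ and some pairwise parallel descending cycles $\pi_1,\dots,\pi_k$ of $\{1,\dots,n\}$ (the empty product being $e$). -/

import Mathlib

namespace BandBraid

/-- Artin's defining relations of the braid group on `n` strands. The generator with index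
`i : Fin (n - 1)` (counted from `0`) is the elementary braid on the strands `i` and `i + 1`. -/
def artinRels (n : ℕ) : Set (FreeGroup (Fin (n - 1))) :=
  {r | ∃ i j : Fin (n - 1), (i : ℕ) + 1 < j ∧
      r = (FreeGroup.of i * FreeGroup.of j) * (FreeGroup.of j * FreeGroup.of i)⁻¹} ∪
  {r | ∃ i j : Fin (n - 1), (i : ℕ) + 1 = j ∧
      r = (FreeGroup.of i * FreeGroup.of j * FreeGroup.of i) *
        (FreeGroup.of j * FreeGroup.of i * FreeGroup.of j)⁻¹}

/-- The braid group `B_n`, given by Artin's presentation. -/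
abbrev BraidGroup (n : ℕ) : Type := PresentedGroup (artinRels n)

/-- The Artin generator exchanging the strands `i` and `i + 1`, where the strands are numbered
`0, …, n - 1`. (It is set to be `1` when there are no such strands; such indices do not occur
below.) -/
def sigma (n i : ℕ) : BraidGroup n :=
  if h : i < n - 1 then PresentedGroup.of ⟨i, h⟩ else 1

/-- The product `σ_{t-1} σ_{t-2} ⋯ σ_{s+1}`. -/
def bandConj (n t s : ℕ) : BraidGroup n :=
  ((List.range' (s + 1) (t - (s + 1))).reverse.map (sigma n)).prod

/-- The band generator
`a_{ts} = (σ_{t-1} ⋯ σ_{s+1}) σ_s (σ_{t-1} ⋯ σ_{s+1})⁻¹`, for strands `s < t`. -/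
def band (n t s : ℕ) : BraidGroup n :=
  bandConj n t s * sigma n s * (bandConj n t s)⁻¹

/-- The monoid `B_n^+` of positive braids inside `B_n`: all products of band generators. -/
def positive (n : ℕ) : Submonoid (BraidGroup n) :=
  Submonoid.closure {x | ∃ t s : Fin n, s < t ∧ x = band n t s}

/-- The relation `V ≤ W`: `W = P₁ V P₂` for some positive braids `P₁`, `P₂`. -/
def BraidLE (n : ℕ) (V W : BraidGroup n) : Prop :=
  ∃ P₁ ∈ positive n, ∃ P₂ ∈ positive n, W = P₁ * V * P₂

/-- The product `a_{t_j t_{j-1}} a_{t_{j-1} t_{j-2}} ⋯ a_{t_2 t_1}` attached to the list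
`[t_j, …, t_1]`. -/
def bandWord (n : ℕ) : List (Fin n) → BraidGroup n
  | t :: s :: l => band n t s * bandWord n (s :: l)
  | _ => 1

/-- The fundamental braid `δ = a_{n(n-1)} a_{(n-1)(n-2)} ⋯ a_{21}` (the strands being numbered
from `0` here). -/
def delta (n : ℕ) : BraidGroup n :=
  ((List.range (n - 1)).reverse.map fun i => band n (i + 1) i).prod

/-- The set `[u, v]` of all braids `W` with `δ^u ≤ W ≤ δ^v`. -/
def interval (n : ℕ) (u v : ℤ) : Set (BraidGroup n) :=
  {W | BraidLE n (delta n ^ u) W ∧ BraidLE n W (delta n ^ v)}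

/-- `π` is a descending cycle `(t_j, t_{j-1}, …, t_1)`, with `j ≥ 2` and `t_j > ⋯ > t_1`. -/
def IsDescendingCycle {n : ℕ} (π : Equiv.Perm (Fin n)) : Prop :=
  ∃ l : List (Fin n), 2 ≤ l.length ∧ l.SortedGT ∧ π = l.formPerm

/-- The braid `δ_π = a_{t_j t_{j-1}} ⋯ a_{t_2 t_1}` of a descending cycle
`π = (t_j, …, t_1)`. The list `[t_j, …, t_1]` is recovered from `π` as the list of the points
moved by `π` in decreasing order; see `deltaCycle_formPerm`. -/
def deltaCycle {n : ℕ} (π : Equiv.Perm (Fin n)) : BraidGroup n :=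
  bandWord n (π.support.sort (· ≥ ·))

theorem deltaCycle_formPerm {n : ℕ} (l : List (Fin n)) (h2 : 2 ≤ l.length)
    (hl : l.SortedGT) : deltaCycle l.formPerm = bandWord n l := by
  have hs : l.formPerm.support = l.toFinset :=
    List.support_formPerm_of_nodup l hl.nodup (by rintro x rfl; simp at h2)
  unfold deltaCycle
  rw [hs, (Finset.sortedGT_sort l.toFinset).eq_of_mem_iff hl (by simp)]

/-- Two descending cycles `π = (t_j, …, t_1)` and `ρ = (s_i, …, s_1)` are parallel: no two entries
of `π` separate two entries of `ρ`, that is,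
`(t_a - s_c)(t_a - s_d)(t_b - s_c)(t_b - s_d) > 0` for all `a < b` and `c < d`. -/
def Parallel {n : ℕ} (π ρ : Equiv.Perm (Fin n)) : Prop :=
  ∀ x ∈ π.support, ∀ y ∈ π.support, x < y → ∀ z ∈ ρ.support, ∀ w ∈ ρ.support, z < w →
    0 < ((x : ℤ) - (z : ℤ)) * ((x : ℤ) - (w : ℤ)) * ((y : ℤ) - (z : ℤ)) * ((y : ℤ) - (w : ℤ))

end BandBraid

namespace BandBraid

variable {n : ℕ}

/-! Both conditions are compared with one class: the "block braids", products of `bandWord` over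
lists of pairwise noncrossing descending blocks. Empty and one-element blocks are allowed and
contribute `1`. Noncrossing blocks commute, so their order is immaterial, and `delta n` is the braid
of the single block of all strands.

The algebra rests on one fact: a chord `(t, s)` of a block cuts it into two noncrossing blocks, and
the braid of the block equals `a_{ts}` times the product of the two pieces (`bandWord_split_left`);
cutting the other way puts `a_{ts}` on the right (`bandWord_split_right`).

If `A` lies in the interval, then `A` is positive and `Q₁ * A * Q₂ = δ` with `Q₁`, `Q₂` positive.
The letters of `Q₁` and `Q₂` are removed one at a time. Each removed letter must be a chord of some
block (`exists_block_of_mem`), so the splitting identity and cancellation in the group leave a block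
braid. The chord property is a dimension count. The exponent sum shows that a positive word for a
block braid has exactly as many letters as a forest spanning the blocks has edges. The permutation
shows that each block is connected by the letters. With no letters to spare, the letters cannot join
anything else. The argument uses only two homomorphisms out of the group, not a solution of the word
problem.

Conversely, a block braid is completed to `δ` by multiplying on the right by band generators, each
merging the block of the largest strand with another one (`exists_merge`). -/

theorem sigma_comm {i j : ℕ} (h : i + 1 < j) : Commute (sigma n i) (sigma n j) := by
  unfold sigma
  split_ifs with h1 h2
  · have := PresentedGroup.one_of_mem (rels := artinRels n)
      (Or.inl ⟨⟨i, h1⟩, ⟨j, h2⟩, h, rfl⟩)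
    rw [map_mul, map_inv, mul_inv_eq_one, map_mul, map_mul] at this
    exact this
  all_goals simp

theorem sigma_braid {i : ℕ} (h : i + 2 < n) :
    sigma n i * sigma n (i + 1) * sigma n i = sigma n (i + 1) * sigma n i * sigma n (i + 1) := by
  unfold sigma
  rw [dif_pos (by omega), dif_pos (by omega)]
  have := PresentedGroup.one_of_mem (rels := artinRels n)
    (Or.inr ⟨⟨i, by omega⟩, ⟨i + 1, by omega⟩, rfl, rfl⟩)
  rw [map_mul, map_inv, mul_inv_eq_one, map_mul, map_mul, map_mul, map_mul] at this
  exact this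

/-! ### Relations between band generators -/

theorem band_succ_self (s : ℕ) : band n (s + 1) s = sigma n s := by
  simp [band, bandConj]

theorem band_succ {t s : ℕ} (h : s < t) :
    band n (t + 1) s = sigma n t * band n t s * (sigma n t)⁻¹ := by
  obtain ⟨d, rfl⟩ := Nat.exists_eq_add_of_lt h
  have : bandConj n (s + d + 1 + 1) s = sigma n (s + d + 1) * bandConj n (s + d + 1) s := by
    unfold bandConj
    rw [show s + d + 1 + 1 - (s + 1) = d + 1 by omega, show s + d + 1 - (s + 1) = d by omega,
      List.range'_concat]
    simp [add_right_comm]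
  unfold band
  rw [this]
  group

theorem commute_band {X : BraidGroup n} {t s : ℕ} (hst : s < t)
    (h : ∀ i, s ≤ i → i < t → Commute X (sigma n i)) : Commute X (band n t s) := by
  induction t, hst using Nat.le_induction with
  | base => rw [band_succ_self]; exact h s le_rfl (by omega)
  | succ t ht ih =>
    rw [band_succ ht]
    have h1 := h t (by omega) (by omega)
    exact (h1.mul_right (ih fun i hi hi' => h i hi (by omega))).mul_right h1.inv_right

theorem sigma_commute_band_outside {i t s : ℕ} (hst : s < t) (h : i + 1 < s ∨ t < i) :
    Commute (sigma n i) (band n t s) := by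
  refine commute_band hst fun j hj hj' => ?_
  rcases h with h | h
  · exact sigma_comm (by omega)
  · exact (sigma_comm (by omega)).symm

/-- For `t = i + 2` this is the braid relation applied to a conjugate of `band n i s`, which
commutes with `σ_{i+1}`. Raising `t` further conjugates by generators far from `σ_i`. -/
theorem sigma_commute_band_inside {i t s : ℕ} (hs : s < i) (ht : i + 1 < t) (hn : t < n) :
    Commute (sigma n i) (band n t s) := by
  induction t, ht using Nat.le_induction with
  | base =>
    rw [band_succ (by omega), band_succ hs]
    have hb := sigma_braid (n := n) (i := i) (by omega)
    have hc := sigma_commute_band_outside (n := n) (i := i + 1) hs (Or.inr (by omega))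
    set a := sigma n i
    set b := sigma n (i + 1)
    set x := band n i s
    have hb' : b * a⁻¹ * b⁻¹ = a⁻¹ * b⁻¹ * a := by
      have : a * (b * a) = b * (a * b) := by simpa [mul_assoc] using hb
      calc b * a⁻¹ * b⁻¹ = a⁻¹ * b⁻¹ * (b * (a * b)) * a⁻¹ * b⁻¹ := by group
        _ = a⁻¹ * b⁻¹ * (a * (b * a)) * a⁻¹ * b⁻¹ := by rw [this]
        _ = _ := by group
    change a * (b * (a * x * a⁻¹) * b⁻¹) = b * (a * x * a⁻¹) * b⁻¹ * a
    calc a * (b * (a * x * a⁻¹) * b⁻¹) = (a * b * a) * x * a⁻¹ * b⁻¹ := by group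
      _ = b * a * (b * x) * a⁻¹ * b⁻¹ := by rw [hb]; group
      _ = b * a * x * (b * a⁻¹ * b⁻¹) := by rw [hc.eq]; group
      _ = _ := by rw [hb']; group
  | succ t ht ih =>
    rw [band_succ (by omega)]
    have h1 : Commute (sigma n i) (sigma n t) := sigma_comm (by omega)
    exact (h1.mul_right (ih (by omega))).mul_right h1.inv_right

/-- Conjugating at the lower end gives the same band; this permits induction on the lower index in
`sigma_band_braid`. -/
theorem band_lower {t s : ℕ} (hs : s + 1 < t) (hn : t < n) :
    band n t s = (sigma n s)⁻¹ * band n t (s + 1) * sigma n s := by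
  induction t, hs using Nat.le_induction with
  | base =>
    rw [band_succ (by omega), band_succ_self, band_succ_self]
    have hb := sigma_braid (n := n) (i := s) (by omega)
    rw [mul_inv_eq_iff_eq_mul, mul_assoc, mul_assoc, eq_inv_mul_iff_mul_eq]
    simpa [mul_assoc] using hb
  | succ t ht ih =>
    rw [band_succ (by omega), band_succ (s := s + 1) (by omega), ih (by omega)]
    have h1 : Commute (sigma n s) (sigma n t) := sigma_comm (by omega)
    set a := sigma n s
    set b := sigma n t
    calc b * (a⁻¹ * band n t (s + 1) * a) * b⁻¹
        = (b * a⁻¹) * band n t (s + 1) * (a * b⁻¹) := by group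
      _ = (a⁻¹ * b) * band n t (s + 1) * (b⁻¹ * a) := by
        rw [h1.symm.inv_right.eq, h1.inv_right.eq]
      _ = _ := by group

theorem band_mul_band_left {t s r : ℕ} (hr : r < s) (hs : s < t) :
    band n t s * band n s r = band n t r * band n t s := by
  induction t, hs using Nat.le_induction with
  | base => rw [band_succ_self, band_succ hr]; group
  | succ t ht ih =>
    have hc := sigma_commute_band_outside (n := n) (i := t) hr (Or.inr (by omega))
    rw [band_succ ht, band_succ (s := r) (by omega)]
    set b := sigma n t
    calc b * band n t s * b⁻¹ * band n s r = b * band n t s * (b⁻¹ * band n s r) := by group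
      _ = b * (band n t s * band n s r) * b⁻¹ := by rw [hc.inv_left.eq]; group
      _ = _ := by rw [ih]; group

theorem sigma_band_braid {s r : ℕ} (hr : r < s) (hs : s + 1 < n) :
    sigma n s * band n s r * sigma n s = band n s r * sigma n s * band n s r := by
  obtain ⟨d, rfl⟩ := Nat.exists_eq_add_of_lt hr
  induction d generalizing r with
  | zero =>
    rw [add_zero, band_succ_self]
    exact (sigma_braid (by omega)).symm
  | succ d ih =>
    have := ih (r := r + 1) (by omega) (by omega)
    rw [show r + 1 + d + 1 = r + (d + 1) + 1 by omega] at this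
    rw [band_lower (by omega) (by omega)]
    have h1 : Commute (sigma n r) (sigma n (r + (d + 1) + 1)) := sigma_comm (by omega)
    set a := sigma n r
    set b := sigma n (r + (d + 1) + 1)
    set x := band n (r + (d + 1) + 1) (r + 1)
    calc b * (a⁻¹ * x * a) * b = (b * a⁻¹) * x * (a * b) := by group
      _ = a⁻¹ * (b * x * b) * a := by rw [h1.symm.inv_right.eq, h1.eq]; group
      _ = a⁻¹ * x * (b * a) * (a⁻¹ * x * a) := by rw [this]; group
      _ = _ := by rw [← h1.eq]; group

/-- With `band_mul_band_left` this gives three factorizations of one triangle braid, by any two of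
its sides in the right cyclic order. -/
theorem band_mul_band_right {t s r : ℕ} (hr : r < s) (hs : s < t) (ht : t < n) :
    band n t s * band n s r = band n s r * band n t r := by
  induction t, hs using Nat.le_induction with
  | base =>
    rw [band_succ_self, band_succ hr, ← mul_assoc, ← mul_assoc, eq_mul_inv_iff_mul_eq]
    exact sigma_band_braid hr ht
  | succ t hst ih =>
    have hc := sigma_commute_band_outside (n := n) (i := t) hr (Or.inr (by omega))
    rw [band_succ hst, band_succ (s := r) (by omega)]
    set b := sigma n t
    calc b * band n t s * b⁻¹ * band n s r = b * band n t s * (b⁻¹ * band n s r) := by group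
      _ = b * (band n t s * band n s r) * b⁻¹ := by rw [hc.inv_left.eq]; group
      _ = (b * band n s r) * band n t r * b⁻¹ := by rw [ih (by omega)]; group
      _ = _ := by rw [hc.eq]; group

theorem band_commute_disjoint {t s r q : ℕ} (h1 : s < t) (h2 : r < s) (h3 : q < r) :
    Commute (band n t s) (band n r q) :=
  commute_band h3 fun _ _ _ => (sigma_commute_band_outside h1 (Or.inl (by omega))).symm

theorem band_commute_nested {t s r q : ℕ} (h1 : s < q) (h2 : q < r) (h3 : r < t) (ht : t < n) :
    Commute (band n t s) (band n r q) :=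
  commute_band h2 fun _ _ _ => (sigma_commute_band_inside (by omega) (by omega) ht).symm

theorem band_commute {t s r q : Fin n} (h1 : s < t) (h2 : q < r)
    (h : 0 < ((t : ℤ) - r) * ((t : ℤ) - q) * ((s : ℤ) - r) * ((s : ℤ) - q)) :
    Commute (band n t s) (band n r q) := by
  rw [Fin.lt_def] at h1 h2
  by_cases a1 : (r : ℕ) < s
  · exact band_commute_disjoint h1 a1 h2
  by_cases a2 : (t : ℕ) < q
  · exact (band_commute_disjoint h2 a2 h1).symm
  by_cases a3 : (r : ℕ) < t ∧ (s : ℕ) < q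
  · exact band_commute_nested a3.2 h2 a3.1 t.2
  by_cases a4 : (t : ℕ) < r ∧ (q : ℕ) < s
  · exact (band_commute_nested a4.2 h1 a4.1 r.2).symm
  -- In every remaining configuration the chords cross or share an endpoint, so the product of
  -- differences is at most zero.
  exfalso
  have b1 : (s : ℤ) - r ≤ 0 := by omega
  have b2 : 0 ≤ (t : ℤ) - q := by omega
  have b3 : ((t : ℤ) - r) * ((s : ℤ) - q) ≥ 0 := by
    by_cases c : (r : ℕ) < t
    · exact mul_nonneg (by omega) (by omega)
    · rcases Nat.lt_or_ge (t : ℕ) r with c' | c'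
      · exact mul_nonneg_of_nonpos_of_nonpos (by omega) (by omega)
      · rw [show (t : ℤ) - r = 0 by omega, zero_mul]
  nlinarith [mul_nonneg b3 (mul_nonneg b2 (neg_nonneg.2 b1))]

/-! ### Noncrossing blocks and cutting a block along a chord -/

/-- No two entries of `l` separate two entries of `m`, and the two lists have no common entry. -/
def Noncrossing (l m : List (Fin n)) : Prop :=
  ∀ x ∈ l, ∀ y ∈ l, ∀ z ∈ m, ∀ w ∈ m,
    0 < ((x : ℤ) - z) * ((x : ℤ) - w) * ((y : ℤ) - z) * ((y : ℤ) - w)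

theorem Noncrossing.symm {l m : List (Fin n)} (h : Noncrossing l m) : Noncrossing m l := by
  intro x hx y hy z hz w hw
  have := h z hz w hw x hx y hy
  linarith

theorem Noncrossing.mono {l m l' m' : List (Fin n)} (h : Noncrossing l m)
    (hl : l' ⊆ l) (hm : m' ⊆ m) : Noncrossing l' m' :=
  fun x hx y hy z hz w hw => h x (hl hx) y (hl hy) z (hm hz) w (hm hw)

theorem Noncrossing.notMem {l m : List (Fin n)} (h : Noncrossing l m) {x : Fin n}
    (hx : x ∈ l) : x ∉ m := fun hm => by
  have := h x hx x hx x hm x hm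
  simp at this

theorem noncrossing_of_pos {l m : List (Fin n)}
    (h : ∀ x ∈ l, ∀ z ∈ m, ∀ w ∈ m, 0 < ((x : ℤ) - z) * ((x : ℤ) - w)) : Noncrossing l m := by
  intro x hx y hy z hz w hw
  rw [mul_assoc]
  exact mul_pos (h x hx z hz w hw) (h y hy z hz w hw)

theorem noncrossing_of_side {l m : List (Fin n)}
    (h : ∀ x ∈ l, (∀ z ∈ m, x < z) ∨ ∀ z ∈ m, z < x) : Noncrossing l m := by
  refine noncrossing_of_pos fun x hx z hz w hw => ?_
  rcases h x hx with h | h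
  · have h1 := Fin.lt_def.1 (h z hz)
    have h2 := Fin.lt_def.1 (h w hw)
    exact mul_pos_of_neg_of_neg (by omega) (by omega)
  · have h1 := Fin.lt_def.1 (h z hz)
    have h2 := Fin.lt_def.1 (h w hw)
    exact mul_pos (by omega) (by omega)

theorem bandWord_commute_of {X : BraidGroup n} {l : List (Fin n)} (hl : l.Pairwise (· > ·))
    (h : ∀ x ∈ l, ∀ y ∈ l, y < x → Commute (band n x y) X) : Commute (bandWord n l) X := by
  induction l with
  | nil => exact Commute.one_left _
  | cons t l ih =>
    cases l with
    | nil => exact Commute.one_left _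
    | cons s l =>
      rw [bandWord]
      refine Commute.mul_left (h t (by simp) s (by simp) ?_) (ih hl.of_cons fun x hx y hy =>
        h x (List.mem_cons_of_mem _ hx) y (List.mem_cons_of_mem _ hy))
      exact List.rel_of_pairwise_cons hl (by simp)

theorem Noncrossing.commute {l m : List (Fin n)} (h : Noncrossing l m)
    (hl : l.Pairwise (· > ·)) (hm : m.Pairwise (· > ·)) :
    Commute (bandWord n l) (bandWord n m) := by
  refine bandWord_commute_of hl fun x hx y hy hxy => ?_
  refine (bandWord_commute_of hm fun z hz w hw hzw => ?_).symm
  exact (band_commute hxy hzw (h x hx y hy z hz w hw)).symm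

theorem bandWord_append (U : List (Fin n)) (t : Fin n) (V : List (Fin n)) :
    bandWord n (U ++ t :: V) = bandWord n (U ++ [t]) * bandWord n (t :: V) := by
  induction U with
  | nil => simp [bandWord]
  | cons u U ih =>
    cases U with
    | nil => simp [bandWord]
    | cons v U => simpa [bandWord, mul_assoc] using ih

theorem bandWord_concat_left {t s : Fin n} {M : List (Fin n)}
    (h : (t :: M ++ [s]).Pairwise (· > ·)) :
    bandWord n (t :: M ++ [s]) = band n t s * bandWord n (t :: M) := by
  induction M generalizing t with
  | nil => simp [bandWord]
  | cons m M ih =>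
    have h1 : m < t := List.rel_of_pairwise_cons h (by simp)
    have h2 : s < m := List.rel_of_pairwise_cons h.of_cons (by simp)
    have := ih h.of_cons
    simp only [List.cons_append] at this ⊢
    rw [bandWord, this, bandWord, ← mul_assoc, ← mul_assoc, band_mul_band_left h2 h1]

theorem bandWord_concat_right {t s : Fin n} {M : List (Fin n)}
    (h : (t :: M ++ [s]).Pairwise (· > ·)) :
    bandWord n (t :: M ++ [s]) = bandWord n (M ++ [s]) * band n t s := by
  induction M generalizing t with
  | nil => simp [bandWord]
  | cons m M ih =>
    have h1 : m < t := List.rel_of_pairwise_cons h (by simp)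
    have h2 : s < m := List.rel_of_pairwise_cons h.of_cons (by simp)
    have hc : Commute (band n t m) (bandWord n (M ++ [s])) :=
      (bandWord_commute_of h.of_cons.of_cons fun x hx y hy hxy => (band_commute_disjoint h1
        (List.rel_of_pairwise_cons h.of_cons hx) hxy).symm).symm
    have := ih h.of_cons
    simp only [List.cons_append] at this ⊢
    rw [bandWord, this, ← mul_assoc, hc.eq, mul_assoc, mul_assoc,
      band_mul_band_right h2 h1 t.2]

theorem bandWord_concat_mul_band {t s : Fin n} {U : List (Fin n)}
    (h : (U ++ [t, s]).Pairwise (· > ·)) :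
    bandWord n (U ++ [t]) * band n t s = band n t s * bandWord n (U ++ [s]) := by
  induction U with
  | nil => simp [bandWord]
  | cons u U ih =>
    have hts : s < t := by
      have := (List.pairwise_append.1 h).2.1
      exact List.rel_of_pairwise_cons this (by simp)
    cases U with
    | nil =>
      have : t < u := List.rel_of_pairwise_cons h (by simp)
      simp [bandWord, band_mul_band_right (n := n) hts this u.2]
    | cons v U =>
      have h1 : v < u := List.rel_of_pairwise_cons h (by simp)
      have h2 : t < v := List.rel_of_pairwise_cons h.of_cons (by simp)
      have := ih h.of_cons
      simp only [List.cons_append, bandWord] at this ⊢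
      rw [mul_assoc, this, ← mul_assoc, (band_commute_disjoint h1 h2 hts).eq, mul_assoc]

theorem band_mul_bandWord {t s : Fin n} {V : List (Fin n)}
    (h : (t :: s :: V).Pairwise (· > ·)) :
    band n t s * bandWord n (s :: V) = bandWord n (t :: V) * band n t s := by
  cases V with
  | nil => simp [bandWord]
  | cons v V =>
    have h1 : s < t := List.rel_of_pairwise_cons h (by simp)
    have h2 : v < s := List.rel_of_pairwise_cons h.of_cons (by simp)
    have hc : Commute (bandWord n (v :: V)) (band n t s) :=
      bandWord_commute_of h.of_cons.of_cons fun x hx y hy hxy => (band_commute_disjoint h1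
        (List.rel_of_pairwise_cons h.of_cons hx) hxy).symm
    rw [bandWord, bandWord, ← mul_assoc, band_mul_band_left h2 h1, mul_assoc, mul_assoc, hc.eq]

/-- The entries `t :: M` are consecutive in the block, so every other entry lies entirely above or
below them. -/
theorem noncrossing_split_left {t s : Fin n} {U M V : List (Fin n)}
    (h : (U ++ t :: M ++ s :: V).Pairwise (· > ·)) : Noncrossing (U ++ s :: V) (t :: M) := by
  refine noncrossing_of_side fun x hx => ?_
  rw [List.pairwise_append, List.pairwise_append] at h
  rcases List.mem_append.1 hx with hx | hx
  · exact Or.inr fun z hz => h.1.2.2 x hx z hz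
  · exact Or.inl fun z hz => h.2.2 z (List.mem_append_right _ hz) x hx

theorem noncrossing_split_right {t s : Fin n} {U M V : List (Fin n)}
    (h : (U ++ t :: M ++ s :: V).Pairwise (· > ·)) : Noncrossing (U ++ t :: V) (M ++ [s]) := by
  have h' : (((U ++ [t]) ++ (M ++ [s])) ++ V).Pairwise (· > ·) := by simpa using h
  rw [List.pairwise_append, List.pairwise_append] at h'
  refine noncrossing_of_side fun x hx => ?_
  have hx' : x ∈ U ++ [t] ∨ x ∈ V := by simp at hx ⊢; tauto
  rcases hx' with hx | hx
  · exact Or.inr fun z hz => h'.1.2.2 x hx z hz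
  · exact Or.inl fun z hz => h'.2.2 z (List.mem_append_right _ hz) x hx

/-- The chord comes out on the left of the segment from `t` to `s` (`bandWord_concat_left`), then
passes the part above `t`, replacing its endpoint `t` by `s` (`bandWord_concat_mul_band`). -/
theorem bandWord_split_left {t s : Fin n} {U M V : List (Fin n)}
    (h : (U ++ t :: M ++ s :: V).Pairwise (· > ·)) :
    bandWord n (U ++ t :: M ++ s :: V) =
      band n t s * (bandWord n (U ++ s :: V) * bandWord n (t :: M)) := by
  have e1 := bandWord_append U t (M ++ s :: V)
  have e2 := bandWord_append (t :: M) s V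
  have h1 : (t :: M ++ [s]).Pairwise (· > ·) := h.sublist (by simp)
  have h2 : (U ++ [t, s]).Pairwise (· > ·) := h.sublist (by simp)
  have hc : Commute (bandWord n (t :: M)) (bandWord n (s :: V)) :=
    ((noncrossing_split_left h).symm.mono (List.Subset.refl _) (by simp)).commute
      (h.sublist (by simp)) (h.sublist (List.sublist_append_right _ _))
  simp only [List.append_assoc, List.cons_append] at e1 e2 h1 ⊢
  rw [e1, e2, ← List.cons_append, bandWord_concat_left h1, bandWord_append U s V, mul_assoc,
    hc.eq, ← mul_assoc, bandWord_concat_mul_band h2]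
  simp only [mul_assoc]

theorem bandWord_split_right {t s : Fin n} {U M V : List (Fin n)}
    (h : (U ++ t :: M ++ s :: V).Pairwise (· > ·)) :
    bandWord n (U ++ t :: M ++ s :: V) =
      bandWord n (U ++ t :: V) * bandWord n (M ++ [s]) * band n t s := by
  have e1 := bandWord_append U t (M ++ s :: V)
  have e2 := bandWord_append (t :: M) s V
  have h1 : (t :: M ++ [s]).Pairwise (· > ·) := h.sublist (by simp)
  have h2 : (t :: s :: V).Pairwise (· > ·) := h.sublist (by simp)
  have hc : Commute (bandWord n (M ++ [s])) (bandWord n (t :: V)) :=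
    ((noncrossing_split_right h).symm.mono (List.Subset.refl _) (by simp)).commute
      (h.sublist (by simp)) (h2.sublist (by simp))
  simp only [List.append_assoc, List.cons_append] at e1 e2 h1 ⊢
  rw [e1, e2, ← List.cons_append, bandWord_concat_right h1, bandWord_append U t V, mul_assoc,
    band_mul_bandWord h2]
  simp only [← mul_assoc]
  rw [mul_assoc (bandWord n (U ++ [t])), hc.eq]
  simp only [← mul_assoc]

/-! ### Permutation and exponent sum of a braid -/

/-- The transposition of `i` and `i + 1`. -/
def adjSwap (i : Fin (n - 1)) : Equiv.Perm (Fin n) :=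
  Equiv.swap ⟨i, by omega⟩ ⟨i + 1, by omega⟩

theorem swap_braid {a b c : Fin n} (h1 : a ≠ b) (h2 : b ≠ c) (h3 : a ≠ c) :
    Equiv.swap a b * Equiv.swap b c * Equiv.swap a b =
      Equiv.swap b c * Equiv.swap a b * Equiv.swap b c := by
  rw [Equiv.swap_mul_swap_mul_swap h1 h3, Equiv.swap_comm a b, Equiv.swap_comm b c,
    Equiv.swap_mul_swap_mul_swap h2.symm h3.symm, Equiv.swap_comm]

theorem adjSwap_rels : ∀ r ∈ artinRels n, FreeGroup.lift (adjSwap (n := n)) r = 1 := by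
  rintro r (⟨i, j, h, rfl⟩ | ⟨i, j, h, rfl⟩)
  · simp only [map_mul, map_inv, FreeGroup.lift_apply_of, mul_inv_eq_one, adjSwap]
    refine (Equiv.Perm.Disjoint.commute ?_).eq
    refine Equiv.Perm.disjoint_iff_disjoint_support.2 ?_
    rw [Equiv.Perm.support_swap (by simp [Fin.ext_iff]),
      Equiv.Perm.support_swap (by simp [Fin.ext_iff])]
    simp [Fin.ext_iff]
    omega
  · simp only [map_mul, map_inv, FreeGroup.lift_apply_of, mul_inv_eq_one, adjSwap, ← h]
    exact swap_braid (by simp [Fin.ext_iff]) (by simp [Fin.ext_iff])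
      (by simp [Fin.ext_iff]; omega)

/-- The homomorphism from the braid group to the symmetric group. -/
def permHom (n : ℕ) : BraidGroup n →* Equiv.Perm (Fin n) :=
  PresentedGroup.toGroup adjSwap_rels

theorem permHom_sigma {i : ℕ} (h : i + 1 < n) :
    permHom n (sigma n i) = Equiv.swap ⟨i, by omega⟩ ⟨i + 1, h⟩ := by
  rw [sigma, dif_pos (by omega), permHom, PresentedGroup.toGroup.of, adjSwap]

theorem permHom_band_nat {t s : ℕ} (hst : s < t) (ht : t < n) :
    permHom n (band n t s) = Equiv.swap ⟨t, ht⟩ ⟨s, by omega⟩ := by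
  induction t, hst using Nat.le_induction with
  | base => rw [band_succ_self, permHom_sigma ht, Equiv.swap_comm]
  | succ t hst ih =>
    rw [band_succ hst, map_mul, map_mul, map_inv, ih (by omega), permHom_sigma ht,
      ← Equiv.swap_apply_apply, Equiv.swap_apply_left, Equiv.swap_apply_of_ne_of_ne]
    all_goals simp [Fin.ext_iff]; omega

theorem permHom_band {t s : Fin n} (hst : s < t) :
    permHom n (band n t s) = Equiv.swap t s :=
  permHom_band_nat hst t.2

theorem permHom_bandWord {l : List (Fin n)} (hl : l.Pairwise (· > ·)) :
    permHom n (bandWord n l) = l.formPerm := by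
  induction l with
  | nil => simp [bandWord]
  | cons t l ih =>
    cases l with
    | nil => simp [bandWord]
    | cons s l =>
      rw [bandWord, map_mul, permHom_band (List.rel_of_pairwise_cons hl (by simp)),
        ih hl.of_cons, List.formPerm_cons_cons]

/-- The exponent sum of a braid. -/
def expSum (n : ℕ) : BraidGroup n →* Multiplicative ℤ :=
  PresentedGroup.toGroup (f := fun _ => Multiplicative.ofAdd 1) (by
    rintro r (⟨i, j, h, rfl⟩ | ⟨i, j, h, rfl⟩) <;> simp)

theorem expSum_band {t s : Fin n} (hst : s < t) :
    expSum n (band n t s) = Multiplicative.ofAdd 1 := by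
  have : (s : ℕ) < n - 1 := by omega
  rw [band, map_mul, map_mul, map_inv, mul_comm, inv_mul_cancel_left, sigma, dif_pos this, expSum,
    PresentedGroup.toGroup.of]

theorem expSum_bandWord {l : List (Fin n)} (hl : l.Pairwise (· > ·)) :
    expSum n (bandWord n l) = Multiplicative.ofAdd (l.tail.length : ℤ) := by
  induction l with
  | nil => simp [bandWord]
  | cons t l ih =>
    cases l with
    | nil => simp [bandWord]
    | cons s l =>
      rw [bandWord, map_mul, expSum_band (List.rel_of_pairwise_cons hl (by simp)),
        ih hl.of_cons, ← ofAdd_add]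
      simp [add_comm]

/-- The product of the band generators whose indices are listed in `w`. -/
def bandProd (n : ℕ) (w : List (Fin n × Fin n)) : BraidGroup n :=
  (w.map fun e => band n e.1 e.2).prod

theorem expSum_bandProd {w : List (Fin n × Fin n)} (hw : ∀ e ∈ w, e.2 < e.1) :
    expSum n (bandProd n w) = Multiplicative.ofAdd (w.length : ℤ) := by
  induction w with
  | nil => simp [bandProd]
  | cons e w ih =>
    have := ih fun e he => hw e (List.mem_cons_of_mem _ he)
    simp only [bandProd] at this
    simp only [bandProd, List.map_cons, List.prod_cons, map_mul,
      expSum_band (hw e (by simp)), this, ← ofAdd_add]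
    simp [add_comm]

theorem mem_positive_iff {X : BraidGroup n} :
    X ∈ positive n ↔ ∃ w : List (Fin n × Fin n), (∀ e ∈ w, e.2 < e.1) ∧ X = bandProd n w := by
  constructor
  · intro h
    induction h using Submonoid.closure_induction with
    | mem x hx =>
      obtain ⟨t, s, h, rfl⟩ := hx
      exact ⟨[(t, s)], by simpa using h, by simp [bandProd]⟩
    | one => exact ⟨[], by simp, by simp [bandProd]⟩
    | mul x y _ _ hx hy =>
      obtain ⟨w, hw, rfl⟩ := hx
      obtain ⟨w', hw', rfl⟩ := hy
      refine ⟨w ++ w', fun e he => ?_, by simp [bandProd]⟩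
      rcases List.mem_append.1 he with he | he
      exacts [hw e he, hw' e he]
  · rintro ⟨w, hw, rfl⟩
    refine Submonoid.list_prod_mem _ fun x hx => ?_
    obtain ⟨e, he, rfl⟩ := List.mem_map.1 hx
    exact Submonoid.subset_closure ⟨e.1, e.2, hw e he, rfl⟩

/-! ### Dimension count: letters of a positive word against blocks -/

/-- The functions that take equal values at the two ends of each pair in `w`. -/
def edgeSpace (w : List (Fin n × Fin n)) : Submodule ℚ (Fin n → ℚ) where
  carrier := {f | ∀ e ∈ w, f e.1 = f e.2}
  add_mem' hf hg e he := by simp [hf e he, hg e he]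
  zero_mem' := by simp
  smul_mem' c f hf e he := by simp [hf e he]

/-- Each pair imposes one linear condition, so the codimension is at most the number of pairs. -/
theorem le_finrank_edgeSpace (w : List (Fin n × Fin n)) :
    n ≤ Module.finrank ℚ (edgeSpace w) + w.length := by
  let φ : (Fin n → ℚ) →ₗ[ℚ] (Fin w.length → ℚ) :=
    LinearMap.pi fun i => LinearMap.proj (R := ℚ) (φ := fun _ : Fin n => ℚ) (w.get i).1 -
      LinearMap.proj (R := ℚ) (φ := fun _ : Fin n => ℚ) (w.get i).2
  have hker : LinearMap.ker φ ≤ edgeSpace w := by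
    intro f hf e he
    obtain ⟨i, rfl⟩ := List.get_of_mem he
    have := congrFun (LinearMap.mem_ker.1 hf) i
    simpa [φ, sub_eq_zero] using this
  have h1 := LinearMap.finrank_range_add_finrank_ker φ
  have h2 := Submodule.finrank_mono hker
  have h3 := Submodule.finrank_le (LinearMap.range φ)
  simp only [Module.finrank_fin_fun] at h1 h3
  omega

theorem edgeSpace_invariant {w : List (Fin n × Fin n)} (hw : ∀ e ∈ w, e.2 < e.1)
    {f : Fin n → ℚ} (hf : f ∈ edgeSpace w) (x : Fin n) :
    f (permHom n (bandProd n w) x) = f x := by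
  induction w generalizing x with
  | nil => simp [bandProd]
  | cons e w ih =>
    have := ih (fun e he => hw e (List.mem_cons_of_mem _ he))
      (fun e he => hf e (List.mem_cons_of_mem _ he)) x
    have he := hf e (by simp)
    simp only [bandProd, List.map_cons, List.prod_cons, map_mul,
      permHom_band (hw e (by simp)), Equiv.Perm.mul_apply] at this ⊢
    rw [← this, Equiv.swap_apply_def]
    split_ifs with h1 h2
    · rw [h1, he]
    · rw [h2, he]
    · rfl

/-- The functions that are constant on each list of `L`. -/
def blockSpace (L : List (List (Fin n))) : Submodule ℚ (Fin n → ℚ) where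
  carrier := {f | ∀ l ∈ L, ∀ x ∈ l, ∀ y ∈ l, f x = f y}
  add_mem' hf hg l hl x hx y hy := by simp [hf l hl x hx y hy, hg l hl x hx y hy]
  zero_mem' := by simp
  smul_mem' c f hf l hl x hx y hy := by simp [hf l hl x hx y hy]

/-- A list of strictly descending, pairwise noncrossing lists. -/
structure IsBlockList (L : List (List (Fin n))) : Prop where
  desc : ∀ l ∈ L, l.Pairwise (· > ·)
  noncrossing : L.Pairwise Noncrossing

theorem IsBlockList.perm {L L' : List (List (Fin n))} (h : IsBlockList L) (hp : L.Perm L') :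
    IsBlockList L' :=
  ⟨fun l hl => h.desc l (hp.mem_iff.2 hl),
    (hp.pairwise_iff Noncrossing.symm).1 h.noncrossing⟩

/-- The product of the braids attached to the lists in `L`. -/
def blockProd (n : ℕ) (L : List (List (Fin n))) : BraidGroup n :=
  (L.map (bandWord n)).prod

theorem IsBlockList.prod_perm {L L' : List (List (Fin n))} (h : IsBlockList L)
    (hp : L.Perm L') : blockProd n L = blockProd n L' := by
  refine (hp.map _).prod_eq' (List.pairwise_map.2 ?_)
  exact h.noncrossing.imp_of_mem fun hl hm hlm => hlm.commute (h.desc _ hl) (h.desc _ hm)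

instance : Std.Symm (Noncrossing (n := n)) := ⟨fun _ _ => Noncrossing.symm⟩

theorem IsBlockList.eq_of_mem {L : List (List (Fin n))} (h : IsBlockList L) {l m : List (Fin n)}
    (hl : l ∈ L) (hm : m ∈ L) {x : Fin n} (hxl : x ∈ l) (hxm : x ∈ m) : l = m := by
  by_contra hne
  exact (h.noncrossing.forall hl hm hne).notMem hxl hxm

theorem expSum_blockProd {L : List (List (Fin n))} (h : ∀ l ∈ L, l.Pairwise (· > ·)) :
    expSum n (blockProd n L) = Multiplicative.ofAdd ((L.flatMap List.tail).length : ℤ) := by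
  induction L with
  | nil => simp [blockProd]
  | cons l L ih =>
    have := ih fun l hl => h l (List.mem_cons_of_mem _ hl)
    simp only [blockProd] at this
    simp only [blockProd, List.map_cons, List.prod_cons, map_mul,
      expSum_bandWord (h l (by simp)), this, ← ofAdd_add]
    simp

theorem permHom_blockProd_apply {L : List (List (Fin n))} (h : IsBlockList L) {l : List (Fin n)}
    (hl : l ∈ L) {x : Fin n} (hx : x ∈ l) :
    permHom n (blockProd n L) x = l.formPerm x := by
  have hp := List.perm_cons_erase hl
  have h' := h.perm hp
  have hfix : ∀ M : List (List (Fin n)), (∀ m ∈ M, m.Pairwise (· > ·) ∧ x ∉ m) →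
      permHom n (blockProd n M) x = x := by
    intro M hM
    induction M with
    | nil => simp [blockProd]
    | cons m M ih =>
      have := ih fun m hm => hM m (List.mem_cons_of_mem _ hm)
      simp only [blockProd] at this
      have hm := hM m (by simp)
      simp only [blockProd, List.map_cons, List.prod_cons, map_mul, permHom_bandWord hm.1,
        Equiv.Perm.mul_apply, this]
      exact List.formPerm_apply_of_notMem hm.2
  have := hfix (L.erase l) fun m hm => ⟨h'.desc m (List.mem_cons_of_mem _ hm),
    (List.rel_of_pairwise_cons h'.noncrossing hm).notMem hx⟩
  rw [h.prod_perm hp]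
  simp only [blockProd, List.map_cons, List.prod_cons, map_mul, Equiv.Perm.mul_apply,
    permHom_bandWord (h.desc l hl)] at this ⊢
  rw [this]

theorem nodup_of_desc {l : List (Fin n)} (h : l.Pairwise (· > ·)) : l.Nodup :=
  h.imp fun h => ne_of_gt h

theorem eq_of_formPerm_invariant {l : List (Fin n)} (hl : l.Nodup) {f : Fin n → ℚ}
    (hf : ∀ x ∈ l, f (l.formPerm x) = f x) {x y : Fin n} (hx : x ∈ l) (hy : y ∈ l) :
    f x = f y := by
  have key : ∀ i (hi : i < l.length), f l[i] = f (l[0]'(by omega)) := by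
    intro i
    induction i with
    | zero => intro _; rfl
    | succ i ih =>
      intro hi
      rw [← ih (by omega), ← hf l[i] (List.getElem_mem (by omega)),
        List.formPerm_apply_lt_getElem _ hl i hi]
  obtain ⟨i, hi, rfl⟩ := List.getElem_of_mem hx
  obtain ⟨j, hj, rfl⟩ := List.getElem_of_mem hy
  rw [key i hi, key j hj]

/-- A function respecting the letters is invariant under the permutation of the word, and each block
is contained in one orbit of it. -/
theorem edgeSpace_le_blockSpace {L : List (List (Fin n))} (h : IsBlockList L)
    {w : List (Fin n × Fin n)} (hw : ∀ e ∈ w, e.2 < e.1) (e : bandProd n w = blockProd n L) :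
    edgeSpace w ≤ blockSpace L := by
  intro f hf l hl x hx y hy
  refine eq_of_formPerm_invariant (nodup_of_desc (h.desc l hl)) (fun z hz => ?_) hx hy
  rw [← permHom_blockProd_apply h hl hz, ← e, edgeSpace_invariant hw hf]

/-- A blockwise constant function is determined by its values off the tails, since each tail entry
shares its value with the head of its block. -/
theorem finrank_blockSpace_le {L : List (List (Fin n))} (h : IsBlockList L) :
    Module.finrank ℚ (blockSpace L) + (L.flatMap List.tail).length ≤ n := by
  have hnd : (L.flatMap List.tail).Nodup := by
    rw [List.nodup_flatMap]
    refine ⟨fun l hl => (nodup_of_desc (h.desc l hl)).tail, h.noncrossing.imp fun hlm x hx hy =>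
      hlm.notMem (List.mem_of_mem_tail hx) (List.mem_of_mem_tail hy)⟩
  set T : Finset (Fin n) := (L.flatMap List.tail).toFinset with hT
  let φ : blockSpace L →ₗ[ℚ] ((Tᶜ : Finset (Fin n)) → ℚ) :=
    (LinearMap.funLeft ℚ ℚ Subtype.val).comp (blockSpace L).subtype
  have hφ : Function.Injective φ := by
    refine (injective_iff_map_eq_zero φ).2 fun f hf => ?_
    have hz : ∀ x ∉ T, (f : Fin n → ℚ) x = 0 := fun x hx =>
      congrFun hf ⟨x, Finset.mem_compl.2 hx⟩
    ext x
    by_cases hx : x ∈ T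
    · rw [hT, List.mem_toFinset, List.mem_flatMap] at hx
      obtain ⟨l, hl, hx⟩ := hx
      cases l with
      | nil => simp at hx
      | cons y l =>
        rw [f.2 _ hl x (List.mem_of_mem_tail hx) y (by simp)]
        refine hz y fun hy => ?_
        rw [hT, List.mem_toFinset, List.mem_flatMap] at hy
        obtain ⟨m, hm, hy⟩ := hy
        have := h.eq_of_mem hl hm (List.mem_cons_self) (List.mem_of_mem_tail hy)
        subst this
        exact (List.nodup_cons.1 (nodup_of_desc (h.desc _ hl))).1 hy
    · exact hz x hx
  have h1 := LinearMap.finrank_le_finrank_of_injective hφ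
  have h2 := Finset.card_compl_add_card T
  rw [hT, List.toFinset_card_of_nodup hnd, ← hT, Fintype.card_fin] at h2
  rw [Module.finrank_fintype_fun_eq_card, Fintype.card_coe] at h1
  omega

/-- Each letter of a positive word for the braid of a list of noncrossing blocks joins two points
of one block. -/
theorem exists_block_of_mem {L : List (List (Fin n))} (h : IsBlockList L)
    {w : List (Fin n × Fin n)} (hw : ∀ e ∈ w, e.2 < e.1) (e : bandProd n w = blockProd n L)
    {t s : Fin n} (hts : (t, s) ∈ w) : ∃ l ∈ L, t ∈ l ∧ s ∈ l := by
  -- Both sides are the exponent sum of the same braid.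
  have hlen : w.length = (L.flatMap List.tail).length := by
    have := expSum_bandProd hw
    rw [e, expSum_blockProd h.desc] at this
    exact_mod_cast (Multiplicative.ofAdd.injective this).symm
  have hle := edgeSpace_le_blockSpace h hw e
  have heq : edgeSpace w = blockSpace L := by
    refine Submodule.eq_of_le_of_finrank_le hle ?_
    have h1 := finrank_blockSpace_le h
    have h2 := le_finrank_edgeSpace w
    omega
  have hst := hw _ hts
  -- Test the equality of spaces on the indicator function of a union of blocks and unblocked
  -- points. Below, `S` is the block of `t`, or `{t}` if `t` lies in no block.
  have key : ∀ S : Finset (Fin n),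
      (∀ l ∈ L, ∀ x ∈ l, ∀ y ∈ l, x ∈ S → y ∈ S) → t ∈ S → s ∈ S := by
    intro S hS ht
    have hmem : (fun x => if x ∈ S then (1 : ℚ) else 0) ∈ blockSpace L := by
      intro l hl x hx y hy
      have : x ∈ S ↔ y ∈ S := ⟨hS l hl x hx y hy, hS l hl y hy x hx⟩
      simp [this]
    rw [← heq] at hmem
    have := hmem _ hts
    by_contra hs
    simp [ht, hs] at this
  by_cases hex : ∃ l ∈ L, t ∈ l
  · obtain ⟨l, hl, ht⟩ := hex
    refine ⟨l, hl, ht, ?_⟩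
    have := key l.toFinset (fun m hm x hx y hy hxl => ?_) (by simpa using ht)
    · simpa using this
    · rw [List.mem_toFinset] at hxl ⊢
      rwa [h.eq_of_mem hl hm hxl hx]
  · push Not at hex
    have := key {t} (fun m hm x hx y hy hxl => ?_) (by simp)
    · simp at this; exact absurd this hst.ne
    · rw [Finset.mem_singleton.1 hxl] at hx
      exact absurd hx (hex m hm)

theorem exists_split {l : List (Fin n)} (hl : l.Pairwise (· > ·)) {t s : Fin n} (ht : t ∈ l)
    (hs : s ∈ l) (hst : s < t) : ∃ U M V, l = U ++ t :: M ++ s :: V := by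
  obtain ⟨U, W, rfl⟩ := List.append_of_mem ht
  have h := List.pairwise_append.1 hl
  have hs' : s ∈ W := by
    rcases List.mem_append.1 hs with hs | hs
    · exact absurd (h.2.2 s hs t (by simp)) hst.not_gt
    · rcases List.mem_cons.1 hs with rfl | hs
      · exact absurd hst (lt_irrefl _)
      · exact hs
  obtain ⟨M, V, rfl⟩ := List.append_of_mem hs'
  exact ⟨U, M, V, by simp⟩

/-! ### Positive divisors of block braids -/

theorem IsBlockList.split {l l₁ l₂ : List (Fin n)} {R : List (List (Fin n))}
    (h : IsBlockList (l :: R)) (h₁ : l₁.Sublist l) (h₂ : l₂.Sublist l)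
    (h₁₂ : Noncrossing l₁ l₂) : IsBlockList (l₁ :: l₂ :: R) := by
  obtain ⟨hd, hp⟩ := h
  rw [List.forall_mem_cons] at hd
  rw [List.pairwise_cons] at hp
  refine ⟨?_, ?_⟩
  · simp only [List.forall_mem_cons]
    exact ⟨hd.1.sublist h₁, hd.1.sublist h₂, hd.2⟩
  · simp only [List.pairwise_cons, List.forall_mem_cons]
    exact ⟨⟨h₁₂, fun m hm => (hp.1 m hm).mono h₁.subset (List.Subset.refl _)⟩,
      fun m hm => (hp.1 m hm).mono h₂.subset (List.Subset.refl _), hp.2⟩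

theorem blockProd_cons (l : List (Fin n)) (L : List (List (Fin n))) :
    blockProd n (l :: L) = bandWord n l * blockProd n L := by
  simp [blockProd]

theorem blockProd_append (L L' : List (List (Fin n))) :
    blockProd n (L ++ L') = blockProd n L * blockProd n L' := by
  simp [blockProd]

/-- `X` is the product of the braids of a list of noncrossing blocks. -/
def IsBlockBraid (X : BraidGroup n) : Prop :=
  ∃ L : List (List (Fin n)), IsBlockList L ∧ X = blockProd n L

theorem isBlockBraid_of_band_mul {X : BraidGroup n} {t s : Fin n} (hst : s < t)
    (hX : X ∈ positive n) (h : IsBlockBraid (band n t s * X)) : IsBlockBraid X := by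
  obtain ⟨L, hL, e⟩ := h
  obtain ⟨w, hw, rfl⟩ := mem_positive_iff.1 hX
  obtain ⟨l, hl, ht, hs⟩ := exists_block_of_mem hL (w := (t, s) :: w) (t := t) (s := s)
    (by simpa using ⟨hst, by simpa using hw⟩) (by simpa [bandProd] using e) (by simp)
  have hp := List.perm_cons_erase hl
  rw [hL.prod_perm hp, blockProd_cons] at e
  have hL' := hL.perm hp
  obtain ⟨U, M, V, hsplit⟩ := exists_split (hL.desc l hl) ht hs hst
  have hd := hL.desc l hl
  generalize L.erase l = R at *
  subst hsplit
  refine ⟨(U ++ s :: V) :: (t :: M) :: R, hL'.split (by simp) (by simp)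
    (noncrossing_split_left hd), ?_⟩
  rw [bandWord_split_left hd, mul_assoc, mul_right_inj] at e
  rw [e, blockProd_cons, blockProd_cons, mul_assoc]

theorem isBlockBraid_of_mul_band {X : BraidGroup n} {t s : Fin n} (hst : s < t)
    (hX : X ∈ positive n) (h : IsBlockBraid (X * band n t s)) : IsBlockBraid X := by
  obtain ⟨L, hL, e⟩ := h
  obtain ⟨w, hw, rfl⟩ := mem_positive_iff.1 hX
  obtain ⟨l, hl, ht, hs⟩ := exists_block_of_mem hL (w := w ++ [(t, s)]) (t := t) (s := s)
    (fun e he => by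
      rcases List.mem_append.1 he with he | he
      · exact hw e he
      · rw [List.mem_singleton.1 he]; exact hst)
    (by simpa [bandProd] using e) (by simp)
  -- The block cut by the chord is moved to the end, so that the split-off generator stands last and
  -- cancels.
  have hp : L.Perm (L.erase l ++ [l]) :=
    (List.perm_cons_erase hl).trans (List.perm_append_singleton _ _).symm
  rw [hL.prod_perm hp, blockProd_append] at e
  have hL' := hL.perm (List.perm_cons_erase hl)
  obtain ⟨U, M, V, hsplit⟩ := exists_split (hL.desc l hl) ht hs hst
  have hd := hL.desc l hl
  generalize L.erase l = R at *
  subst hsplit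
  have hperm : ((U ++ t :: V) :: (M ++ [s]) :: R).Perm (R ++ [U ++ t :: V, M ++ [s]]) :=
    List.perm_append_comm (l₁ := [U ++ t :: V, M ++ [s]])
  refine ⟨R ++ [U ++ t :: V, M ++ [s]], (hL'.split (by simp) ?_
    (noncrossing_split_right hd)).perm hperm, ?_⟩
  · have h1 : (M ++ [s]).Sublist (M ++ s :: V) := by simp
    have h2 : (M ++ s :: V).Sublist (U ++ t :: M ++ s :: V) := by simp
    exact h1.trans h2
  rw [blockProd_cons, bandWord_split_right hd] at e
  simp only [blockProd, List.map_nil, List.prod_nil, mul_one, ← mul_assoc, mul_left_inj] at e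
  rw [e, blockProd_append]
  simp [blockProd, mul_assoc]

theorem isBlockBraid_of_mul_left {P X : BraidGroup n} (hP : P ∈ positive n)
    (hX : X ∈ positive n) (h : IsBlockBraid (P * X)) : IsBlockBraid X := by
  obtain ⟨w, hw, rfl⟩ := mem_positive_iff.1 hP
  induction w with
  | nil => simpa [bandProd] using h
  | cons e w ih =>
    have hw' : ∀ e ∈ w, e.2 < e.1 := fun e he => hw e (List.mem_cons_of_mem _ he)
    have hP' : bandProd n w ∈ positive n := mem_positive_iff.2 ⟨w, hw', rfl⟩
    refine ih hw' hP' (isBlockBraid_of_band_mul (hw e (by simp)) (mul_mem hP' hX) ?_)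
    simpa [bandProd, mul_assoc] using h

theorem isBlockBraid_of_mul_right {P X : BraidGroup n} (hP : P ∈ positive n)
    (hX : X ∈ positive n) (h : IsBlockBraid (X * P)) : IsBlockBraid X := by
  obtain ⟨w, hw, rfl⟩ := mem_positive_iff.1 hP
  induction w using List.reverseRecOn with
  | nil => simpa [bandProd] using h
  | append_singleton w e ih =>
    have hw' : ∀ e ∈ w, e.2 < e.1 := fun e he => hw e (by simp [he])
    have hP' : bandProd n w ∈ positive n := mem_positive_iff.2 ⟨w, hw', rfl⟩
    refine ih hw' hP' (isBlockBraid_of_mul_band (hw e (by simp)) (mul_mem hX hP') ?_)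
    simpa [bandProd, mul_assoc] using h

/-! ### Completing a block braid to the fundamental braid -/

theorem pairwise_reverse_finRange : (List.finRange n).reverse.Pairwise (· > ·) := by
  rw [List.pairwise_reverse]
  exact List.pairwise_lt_finRange n

theorem eq_reverse_finRange {l : List (Fin n)} (hl : l.Pairwise (· > ·)) (h : ∀ x, x ∈ l) :
    l = (List.finRange n).reverse :=
  ((List.perm_ext_iff_of_nodup (nodup_of_desc hl) (nodup_of_desc pairwise_reverse_finRange)).2
    (by simp [h])).eq_of_pairwise (fun _ _ _ _ h1 h2 => absurd h1 (not_lt.2 h2.le)) hl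
      pairwise_reverse_finRange

theorem delta_eq_bandWord : delta n = bandWord n (List.finRange n).reverse := by
  have key : ∀ m (hm : m < n), ∃ l : List (Fin n), (⟨m, hm⟩ :: l).Pairwise (· > ·) ∧
      (∀ x : Fin n, (x : ℕ) < m → x ∈ l) ∧ bandWord n (⟨m, hm⟩ :: l) =
        ((List.range m).reverse.map fun i => band n (i + 1) i).prod := by
    intro m
    induction m with
    | zero => exact fun hm => ⟨[], by simp, by simp, by simp [bandWord]⟩
    | succ m ih =>
      intro hm
      obtain ⟨l, h1, h2, h3⟩ := ih (by omega)
      refine ⟨⟨m, by omega⟩ :: l, ?_, ?_, ?_⟩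
      · rw [List.pairwise_cons]
        refine ⟨fun x hx => ?_, h1⟩
        rcases List.mem_cons.1 hx with rfl | hx
        · simp [Fin.lt_def]
        · have := Fin.lt_def.1 (List.rel_of_pairwise_cons h1 hx)
          simp only [gt_iff_lt, Fin.lt_def] at this ⊢
          omega
      · intro x hx
        rcases Nat.lt_or_ge (x : ℕ) m with h | h
        · exact List.mem_cons_of_mem _ (h2 x h)
        · exact List.mem_cons.2 (Or.inl (Fin.ext (by simp; omega)))
      · rw [bandWord, h3, List.range_succ]
        simp
  rcases Nat.eq_zero_or_pos n with rfl | hn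
  · simp [delta, bandWord]
  · obtain ⟨l, h1, h2, h3⟩ := key (n - 1) (by omega)
    rw [delta, ← h3, eq_reverse_finRange h1]
    intro x
    rcases Nat.lt_or_ge (x : ℕ) (n - 1) with h | h
    · exact List.mem_cons_of_mem _ (h2 x h)
    · exact List.mem_cons.2 (Or.inl (Fin.ext (by simp; omega)))

theorem isBlockBraid_delta : IsBlockBraid (delta n) :=
  ⟨[(List.finRange n).reverse], ⟨by simpa using pairwise_reverse_finRange, by simp⟩,
    by simp [blockProd, delta_eq_bandWord]⟩

theorem exists_block_at {C : List (Fin n)} {L : List (List (Fin n))}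
    (h : IsBlockList (C :: L)) {p : Fin n} (hp : p ∉ C) :
    ∃ E R, p ∈ E ∧ IsBlockList (C :: E :: R) ∧ blockProd n L = blockProd n (E :: R) := by
  by_cases hex : ∃ E ∈ L, p ∈ E
  · obtain ⟨E, hE, hpE⟩ := hex
    have hperm := List.perm_cons_erase hE
    have hL : IsBlockList L := ⟨fun l hl => h.desc l (List.mem_cons_of_mem _ hl),
      h.noncrossing.of_cons⟩
    exact ⟨E, L.erase E, hpE, h.perm (hperm.cons C), hL.prod_perm hperm⟩
  · push Not at hex
    -- A point in no block may be added as a one-element block, which crosses nothing and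
    -- contributes `1`.
    have hside : ∀ l : List (Fin n), p ∉ l → Noncrossing [p] l := by
      intro l hl x hx y hy z hz w hw
      rw [List.mem_singleton.1 hx, List.mem_singleton.1 hy, mul_assoc]
      refine mul_self_pos.2 (mul_ne_zero ?_ ?_) <;> rw [sub_ne_zero] <;> intro e
      · exact hl ((Fin.ext (by exact_mod_cast e) : p = z) ▸ hz)
      · exact hl ((Fin.ext (by exact_mod_cast e) : p = w) ▸ hw)
    obtain ⟨hd, hc⟩ := h
    rw [List.forall_mem_cons] at hd
    rw [List.pairwise_cons] at hc
    refine ⟨[p], L, by simp, ⟨?_, ?_⟩, by simp [blockProd, bandWord]⟩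
    · simpa using hd
    · simp only [List.pairwise_cons, List.forall_mem_cons]
      exact ⟨⟨(hside C hp).symm, hc.1⟩, fun m hm => hside m (hex m hm), hc.2⟩

theorem eq_append_of_desc {l : List (Fin n)} (hl : l.Pairwise (· > ·)) {p : Fin n} (hp : p ∉ l) :
    l = l.filter (p < ·) ++ l.filter (· < p) := by
  induction l with
  | nil => simp
  | cons t l ih =>
    simp only [List.mem_cons, not_or] at hp
    have := ih hl.of_cons hp.2
    rcases lt_or_gt_of_ne hp.1 with h | h
    · simp only [List.filter_cons, h, h.not_gt, decide_true, decide_false, if_true,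
        Bool.false_eq_true, if_false, List.cons_append]
      rw [← this]
    · have h1 : l.filter (p < ·) = [] := by
        rw [List.filter_eq_nil_iff]
        intro x hx
        have := List.rel_of_pairwise_cons hl hx
        simpa using (this.trans h).le
      rw [h1] at this
      simp only [List.filter_cons, h, h.not_gt, decide_true, decide_false, if_true,
        Bool.false_eq_true, if_false, h1, List.nil_append] at this ⊢
      rw [← this]

/-- The block containing the largest strand can be enlarged by right multiplication with a band
generator, as long as it is not the whole set of strands. -/
theorem exists_merge {C : List (Fin n)} {L : List (List (Fin n))} (h : IsBlockList (C :: L))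
    {x : Fin n} (hx : x ∈ C) (hmax : ∀ y, y ≤ x) {p : Fin n} (hp : p ∉ C)
    (hpmax : ∀ y ∉ C, y ≤ p) :
    ∃ (C' : List (Fin n)) (L' : List (List (Fin n))) (a : BraidGroup n), IsBlockList (C' :: L') ∧
      x ∈ C' ∧ C.length < C'.length ∧ a ∈ positive n ∧
      blockProd n (C :: L) * a = blockProd n (C' :: L') := by
  obtain ⟨E, R, hpE, hER, hprod⟩ := exists_block_at h hp
  have hCd := hER.desc C (by simp)
  have hEd := hER.desc E (by simp)
  have hnc := List.pairwise_cons.1 hER.noncrossing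
  have hnE := List.pairwise_cons.1 hnc.2
  have hCE : Noncrossing C E := hnc.1 E (by simp)
  have hxp : p < x := lt_of_le_of_ne (hmax p) fun e => hp (e ▸ hx)
  have hle : ∀ e ∈ E, e ≤ p := fun e he => hpmax e (hCE.symm.notMem he)
  obtain ⟨U, V, hUV, hU, hV⟩ : ∃ U V, C = U ++ V ∧ (∀ u ∈ U, p < u) ∧ (∀ v ∈ V, v < p) :=
    ⟨_, _, eq_append_of_desc hCd hp, by simp, by simp⟩
  -- Otherwise `e < v < p < x`, and the pair `x`, `v` of `C` would separate the pair `p`, `e` of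
  -- `E`. Hence `E` fits into the gap of `C` between `U` and `V`.
  have hVE : ∀ e ∈ E, ∀ v ∈ V, v < e := by
    intro e he v hv
    by_contra hlt
    have hv' : v ∈ C := by simp [hUV, hv]
    have hne : v ≠ e := fun e' => hCE.notMem hv' (e' ▸ he)
    have h1 := Fin.lt_def.1 (lt_of_le_of_ne (not_lt.1 hlt) hne.symm)
    have h2 := Fin.lt_def.1 (hV v hv)
    have h3 := Fin.lt_def.1 hxp
    have h4 := hCE x hx v hv' p hpE e he
    have h5 : 0 < ((x : ℤ) - p) * ((x : ℤ) - e) := mul_pos (by omega) (by omega)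
    rw [mul_assoc] at h4
    have h6 := pos_of_mul_pos_right h4 h5.le
    have h7 : ((v : ℤ) - p) * ((v : ℤ) - e) < 0 := mul_neg_of_neg_of_pos (by omega) (by omega)
    omega
  have hCd' := hUV ▸ hCd
  have hdesc : (U ++ E ++ V).Pairwise (· > ·) := by
    rw [List.pairwise_append] at hCd'
    rw [List.pairwise_append, List.pairwise_append]
    refine ⟨⟨hCd'.1, hEd, fun u hu e he => lt_of_le_of_lt (hle e he) (hU u hu)⟩, hCd'.2.1,
      fun y hy v hv => ?_⟩
    rcases List.mem_append.1 hy with hy | hy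
    · exact hCd'.2.2 y hy v hv
    · exact hVE y hy v hv
  have hxU : x ∈ U := by
    rw [hUV] at hx
    exact (List.mem_append.1 hx).resolve_right fun hx => hxp.not_gt (hV x hx)
  -- The merging generator is `a_{ts}`, with `t` the entry of `C` just above the gap and `s` the
  -- least entry of `E`. Cutting the merged block on the right along this chord gives back `C` and
  -- `E`.
  obtain ⟨U', t, rfl⟩ := List.eq_nil_or_concat' U |>.resolve_left (by rintro rfl; simp at hxU)
  obtain ⟨M, s, rfl⟩ := List.eq_nil_or_concat' E |>.resolve_left (by rintro rfl; simp at hpE)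
  have hdesc' : (U' ++ t :: M ++ s :: V).Pairwise (· > ·) := by simpa using hdesc
  have hts : s < t := lt_of_le_of_lt (hle s (by simp)) (hU t (by simp))
  -- Each other block `G` lies below `p`, by maximality of `p`. Comparing an entry of `C` with `x`,
  -- or one of `E` with `p`, shows that no two entries of `G` have it between them.
  have hnew : ∀ G ∈ R, Noncrossing (U' ++ t :: M ++ s :: V) G := by
    intro G hG
    have hCG := hnc.1 G (by simp [hG])
    have hEG := hnE.1 G hG
    have hGp : ∀ g ∈ G, g < p := fun g hg =>
      lt_of_le_of_ne (hpmax g (hCG.symm.notMem hg)) fun e => hEG.notMem hpE (e ▸ hg)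
    refine noncrossing_of_pos fun y hy z hz w hw => ?_
    have hz' := Fin.lt_def.1 (hGp z hz)
    have hw' := Fin.lt_def.1 (hGp w hw)
    have hxp' := Fin.lt_def.1 hxp
    have hy' : y ∈ C ∨ y ∈ M ++ [s] := by simp [hUV] at hy ⊢; tauto
    rcases hy' with hy | hy
    · have h4 := hCG x hx y hy z hz w hw
      rw [mul_assoc] at h4
      exact pos_of_mul_pos_right h4 (mul_pos (by omega) (by omega)).le
    · have h4 := hEG p hpE y hy z hz w hw
      rw [mul_assoc] at h4
      exact pos_of_mul_pos_right h4 (mul_pos (by omega) (by omega)).le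
  have hnewB : IsBlockList ((U' ++ t :: M ++ s :: V) :: R) :=
    ⟨by simpa only [List.forall_mem_cons] using
      ⟨hdesc', fun G hG => hER.desc G (by simp [hG])⟩, List.pairwise_cons.2 ⟨hnew, hnE.2⟩⟩
  refine ⟨U' ++ t :: M ++ s :: V, R, band n t s, hnewB, ?_, ?_,
    Submonoid.subset_closure ⟨t, s, hts, rfl⟩, ?_⟩
  · simp at hxU ⊢; tauto
  · simp [hUV]
  · rw [blockProd_cons, hprod, ← blockProd_cons,
      hER.prod_perm (List.perm_append_comm (l₁ := [C, M ++ [s]]) (l₂ := R)),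
      hnewB.prod_perm (List.perm_append_singleton _ _).symm, blockProd_append, blockProd_append]
    have hC : C = U' ++ t :: V := by simpa using hUV
    simp only [blockProd, List.map_cons, List.map_nil, List.prod_cons, List.prod_nil, mul_one]
    rw [bandWord_split_right hdesc', hC]
    simp only [mul_assoc]

/-- Induction on a bound `k` for the number of strands missing from the top block, which each merge
enlarges. -/
theorem exists_positive_mul_eq_delta (k : ℕ) : ∀ {C : List (Fin n)} {L : List (List (Fin n))},
    IsBlockList (C :: L) → ∀ {x : Fin n}, x ∈ C → (∀ y, y ≤ x) → n ≤ C.length + k →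
    ∃ P ∈ positive n, blockProd n (C :: L) * P = delta n := by
  induction k with
  | zero =>
    intro C L h x _ _ hk
    have hnd := nodup_of_desc (h.desc C (by simp))
    have hall : ∀ y, y ∈ C := by
      have : C.toFinset = Finset.univ := by
        refine Finset.eq_univ_of_card _ (le_antisymm (Finset.card_le_univ _) ?_)
        rwa [List.toFinset_card_of_nodup hnd, Fintype.card_fin]
      intro y
      rw [← List.mem_toFinset, this]
      exact Finset.mem_univ y
    have hL : ∀ l ∈ L, l = [] := fun l hl => List.eq_nil_iff_forall_not_mem.2 fun y =>
      (List.rel_of_pairwise_cons h.noncrossing hl).notMem (hall y)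
    refine ⟨1, one_mem _, ?_⟩
    rw [mul_one, blockProd_cons, delta_eq_bandWord, eq_reverse_finRange (h.desc C (by simp)) hall,
      mul_eq_left]
    refine List.prod_eq_one fun X hX => ?_
    obtain ⟨l, hl, rfl⟩ := List.mem_map.1 hX
    rw [hL l hl, bandWord]
    simp
  | succ k ih =>
    intro C L h x hx hmax hk
    by_cases hall : ∀ y, y ∈ C
    · refine ih h hx hmax ?_
      rw [eq_reverse_finRange (h.desc C (by simp)) hall]
      simp
    · push Not at hall
      obtain ⟨p, hp, hpmax⟩ := Finset.exists_max_image (C.toFinsetᶜ) id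
        (hall.imp fun y hy => by simpa using hy)
      obtain ⟨C', L', a, h', hx', hlt, ha, e⟩ := exists_merge h hx hmax (p := p) (by simpa using hp)
        fun y hy => hpmax y (by simpa using hy)
      obtain ⟨P, hP, e'⟩ := ih h' hx' hmax (by omega)
      exact ⟨a * P, mul_mem ha hP, by rw [← mul_assoc, e, e']⟩

theorem IsBlockBraid.exists_mul_eq_delta (hn : 1 ≤ n) {X : BraidGroup n} (h : IsBlockBraid X) :
    ∃ P ∈ positive n, X * P = delta n := by
  obtain ⟨L, hL, rfl⟩ := h
  let x : Fin n := ⟨n - 1, by omega⟩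
  -- The empty block is a dummy first block, so that `exists_block_at` can supply a block through
  -- the largest strand.
  have hL' : IsBlockList ([] :: L) :=
    ⟨by simpa using hL.desc, List.pairwise_cons.2 ⟨fun _ _ _ hx => by simp at hx, hL.noncrossing⟩⟩
  obtain ⟨E, R, hx, hER, hprod⟩ := exists_block_at hL' (p := x) (by simp)
  rw [hprod]
  exact exists_positive_mul_eq_delta n (C := E)
    ⟨fun l hl => hER.desc l (by simp [List.mem_cons.1 hl]), hER.noncrossing.of_cons⟩ hx
    (fun y => Fin.le_def.2 (by simp [x]; omega)) (by omega)

/-! ### The interval, and translation between blocks and cycles -/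

theorem bandWord_mem_positive {l : List (Fin n)} (hl : l.Pairwise (· > ·)) :
    bandWord n l ∈ positive n := by
  induction l with
  | nil => exact one_mem _
  | cons t l ih =>
    cases l with
    | nil => exact one_mem _
    | cons s l =>
      exact mul_mem (Submonoid.subset_closure ⟨t, s, List.rel_of_pairwise_cons hl (by simp), rfl⟩)
        (ih hl.of_cons)

theorem IsBlockBraid.mem_positive {X : BraidGroup n} (h : IsBlockBraid X) : X ∈ positive n := by
  obtain ⟨L, hL, rfl⟩ := h
  refine Submonoid.list_prod_mem _ fun Y hY => ?_
  obtain ⟨l, hl, rfl⟩ := List.mem_map.1 hY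
  exact bandWord_mem_positive (hL.desc l hl)

theorem mem_interval_iff (hn : 1 ≤ n) {A : BraidGroup n} :
    A ∈ interval n 0 1 ↔ IsBlockBraid A := by
  simp only [interval, BraidLE, Set.mem_ofPred_eq, zpow_zero, zpow_one, mul_one]
  constructor
  · rintro ⟨⟨P₁, h₁, P₂, h₂, rfl⟩, Q₁, hQ₁, Q₂, hQ₂, e⟩
    have hA := mul_mem h₁ h₂
    refine isBlockBraid_of_mul_left hQ₁ hA (isBlockBraid_of_mul_right hQ₂ (mul_mem hQ₁ hA) ?_)
    rw [← e]
    exact isBlockBraid_delta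
  · intro h
    obtain ⟨P, hP, e⟩ := h.exists_mul_eq_delta hn
    exact ⟨⟨A, h.mem_positive, 1, one_mem _, by simp⟩, 1, one_mem _, P, hP, by simp [e]⟩

theorem bandWord_of_length_lt_two {l : List (Fin n)} (h : l.length < 2) : bandWord n l = 1 := by
  match l, h with
  | [], _ => rfl
  | [_], _ => rfl

theorem support_formPerm_of_desc {l : List (Fin n)} (hl : l.Pairwise (· > ·))
    (h2 : 2 ≤ l.length) : l.formPerm.support = l.toFinset :=
  List.support_formPerm_of_nodup l (nodup_of_desc hl) (by rintro x rfl; simp at h2)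

theorem IsBlockBraid.exists_cycles {X : BraidGroup n} (h : IsBlockBraid X) :
    ∃ L : List (Equiv.Perm (Fin n)), (∀ π ∈ L, IsDescendingCycle π) ∧ L.Pairwise Parallel ∧
      X = (L.map deltaCycle).prod := by
  obtain ⟨L, hL, rfl⟩ := h
  -- Blocks with fewer than two entries are not cycles; dropping them leaves the product unchanged.
  have hmem : ∀ l ∈ L.filter (2 ≤ ·.length), l.Pairwise (· > ·) ∧ 2 ≤ l.length := by
    intro l hl
    rw [List.mem_filter] at hl
    exact ⟨hL.desc l hl.1, by simpa using hl.2⟩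
  refine ⟨(L.filter (2 ≤ ·.length)).map List.formPerm, ?_, ?_, ?_⟩
  · intro π hπ
    obtain ⟨l, hl, rfl⟩ := List.mem_map.1 hπ
    exact ⟨l, (hmem l hl).2, (hmem l hl).1.sortedGT, rfl⟩
  · rw [List.pairwise_map]
    refine (hL.noncrossing.filter _).imp_of_mem fun {l m} hl hm hlm => ?_
    intro x hx y hy _ z hz w hw _
    rw [support_formPerm_of_desc (hmem l hl).1 (hmem l hl).2, List.mem_toFinset] at hx hy
    rw [support_formPerm_of_desc (hmem m hm).1 (hmem m hm).2, List.mem_toFinset] at hz hw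
    exact hlm x hx y hy z hz w hw
  · clear hmem
    obtain ⟨hd, -⟩ := hL
    induction L with
    | nil => simp [blockProd]
    | cons l L ih =>
      have := ih fun l hl => hd l (List.mem_cons_of_mem _ hl)
      rw [blockProd_cons, this, List.filter_cons]
      by_cases h2 : 2 ≤ l.length
      · simp [h2, deltaCycle_formPerm l h2 (hd l (by simp)).sortedGT]
      · simp [h2, bandWord_of_length_lt_two (not_le.1 h2)]

/-- A common entry would give a zero product once a second entry is chosen from each list, so the
lists are disjoint. The cases `x = y` and `z = w` then reduce to nonzero squares. -/
theorem noncrossing_of_parallel {l m : List (Fin n)} (hl : 2 ≤ l.length) (hm : 2 ≤ m.length)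
    (hl' : l.Nodup) (hm' : m.Nodup)
    (h : ∀ x ∈ l, ∀ y ∈ l, x < y → ∀ z ∈ m, ∀ w ∈ m, z < w →
      0 < ((x : ℤ) - z) * ((x : ℤ) - w) * ((y : ℤ) - z) * ((y : ℤ) - w)) : Noncrossing l m := by
  have hother : ∀ k : List (Fin n), 2 ≤ k.length → k.Nodup → ∀ x, ∃ y ∈ k, y ≠ x := by
    intro k hk hk' x
    by_contra hc
    push Not at hc
    have h1 : k.toFinset ⊆ {x} := fun y hy => by simpa using hc y (by simpa using hy)
    have h2 := Finset.card_le_card h1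
    rw [List.toFinset_card_of_nodup hk', Finset.card_singleton] at h2
    omega
  have hne : ∀ x ∈ l, ∀ y ∈ l, x ≠ y → ∀ z ∈ m, ∀ w ∈ m, z ≠ w →
      0 < ((x : ℤ) - z) * ((x : ℤ) - w) * ((y : ℤ) - z) * ((y : ℤ) - w) := by
    intro x hx y hy hxy z hz w hw hzw
    rcases lt_or_gt_of_ne hxy with h1 | h1 <;> rcases lt_or_gt_of_ne hzw with h2 | h2
    · exact h x hx y hy h1 z hz w hw h2
    · linarith [h x hx y hy h1 w hw z hz h2]
    · linarith [h y hy x hx h1 z hz w hw h2]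
    · linarith [h y hy x hx h1 w hw z hz h2]
  have hdisj : ∀ x ∈ l, ∀ z ∈ m, (x : ℤ) - z ≠ 0 := by
    intro x hx z hz h0
    obtain ⟨y, hy, hyx⟩ := hother l hl hl' x
    obtain ⟨w, hw, hwz⟩ := hother m hm hm' z
    have := hne x hx y hy hyx.symm z hz w hw hwz.symm
    simp [h0] at this
  intro x hx y hy z hz w hw
  by_cases hxy : x = y
  · subst hxy
    rw [mul_assoc]
    exact mul_self_pos.2 (mul_ne_zero (hdisj x hx z hz) (hdisj x hx w hw))
  by_cases hzw : z = w
  · subst hzw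
    rw [mul_assoc]
    exact mul_pos (mul_self_pos.2 (hdisj x hx z hz)) (mul_self_pos.2 (hdisj y hy z hz))
  exact hne x hx y hy hxy z hz w hw hzw

theorem isBlockBraid_of_cycles {L : List (Equiv.Perm (Fin n))}
    (hL : ∀ π ∈ L, IsDescendingCycle π) (hp : L.Pairwise Parallel) :
    IsBlockBraid (L.map deltaCycle).prod := by
  have hlen : ∀ π ∈ L, 2 ≤ (π.support.sort (· ≥ ·)).length := by
    intro π hπ
    obtain ⟨l, h2, hl, rfl⟩ := hL π hπ
    rwa [Finset.length_sort, support_formPerm_of_desc hl.pairwise h2,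
      List.toFinset_card_of_nodup hl.nodup]
  refine ⟨L.map fun π => π.support.sort (· ≥ ·), ⟨?_, ?_⟩, ?_⟩
  · intro l hl
    obtain ⟨π, _, rfl⟩ := List.mem_map.1 hl
    exact (Finset.sortedGT_sort _).pairwise
  · rw [List.pairwise_map]
    refine hp.imp_of_mem fun {π ρ} hπ hρ h => ?_
    refine noncrossing_of_parallel (hlen π hπ) (hlen ρ hρ) (Finset.sort_nodup _ _)
      (Finset.sort_nodup _ _) fun x hx y hy hxy z hz w hw hzw => ?_
    rw [Finset.mem_sort] at hx hy hz hw
    exact h x hx y hy hxy z hz w hw hzw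
  · rw [blockProd, List.map_map]
    rfl

end BandBraid

theorem mainTheorem3 (n : ℕ) (hn : 1 ≤ n) (A : BandBraid.BraidGroup n) :
    A ∈ BandBraid.interval n 0 1 ↔
      ∃ L : List (Equiv.Perm (Fin n)),
        (∀ π ∈ L, BandBraid.IsDescendingCycle π) ∧
        L.Pairwise BandBraid.Parallel ∧
        A = (L.map BandBraid.deltaCycle).prod := by
  rw [BandBraid.mem_interval_iff hn]
  constructor
  · exact fun h => h.exists_cycles
  · rintro ⟨L, hL, hp, rfl⟩
    exact BandBraid.isBlockBraid_of_cycles hL hp
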